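/- **Theorem 1.** For $a>0$ let $\beta_a:\mathbb R\to\mathbb R$ be the box function, $\beta_a(t)=1/a$ for $t\in(-a/2,a/2]$ and $\beta_a(t)=0$ otherwise, and let $\varphi_{a,\theta}$ be the measure on $\mathbb R^2$ obtained by rotating $\beta_a(x_1)\,\delta(x_2)$ (the product of $\beta_a(x_1)\,dx_1$ and the Dirac mass at $x_2=0$) by the angle $\theta$. For $N\ge 2$ and $\boldsymbol a=(a_1,\dots,a_N)$ with $a_k>0$, the radially-uniform box spline $\beta^N_{\boldsymbol a}$ is the density, with respect to Lebesgue measure on $\mathbb R^2$, of the convolution $$\varphi_{a_1,\theta_1}*\cdots*\varphi_{a_N,\theta_N},\qquad \theta_k=\frac{(k-1)\pi}{N},$$ where the value of the density at a point is the limit of its averages over shrinking discs centred there (for $N\ge3$ this is the unique continuous density). Let $\sigma>0$ and, for $N\ge2$, let $\boldsymbol a(N)=(a_1(N),\dots,a_N(N))$ with $a_k(N)=\sigma\sqrt{24/N}$ for all $1\le k\le N$. Then $\beta^N_{\boldsymbol a(N)}$ is indeed a nonnegative (almost everywhere) density of this convolution for every $N\ge2$, it is continuous for every $N\ge3$, and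 for every $x\in\mathbb R^2$ $$\lim_{N\to\infty}\beta^N_{\boldsymbol a(N)}(x)=\frac1{2\pi\sigma^2}\exp\left(-\frac{\|x\|^2}{2\sigma^2}\right).$$ -/

import Mathlib

open MeasureTheory Filter Topology

namespace BoxSpline

noncomputable section

/-- The Euclidean plane. -/
abbrev Plane : Type := EuclideanSpace ℝ (Fin 2)

open Classical in
/-- The one-dimensional box function of scale `a`: it is `1 / a` on `(-a/2, a/2]` and `0` elsewhere. -/
def box (a : ℝ) (x : ℝ) : ℝ := if x ∈ Set.Ioc (-a / 2) (a / 2) then 1 / a else 0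

/-- The generating kernel `box a (x₁) δ(x₂)`. Because of the Dirac factor it is not a function, but
a measure on the plane: the product of `box a (x₁) dx₁` and the Dirac mass at `x₂ = 0`. -/
def generatingKernel (a : ℝ) : Measure Plane :=
  (((volume : Measure ℝ).withDensity fun t => ENNReal.ofReal (box a t)).prod
    (Measure.dirac (0 : ℝ))).map (fun p => !₂[p.1, p.2])

/-- The rotation of the plane by the angle `θ`, as a matrix. -/
def rotationMatrix (θ : ℝ) : Matrix (Fin 2) (Fin 2) ℝ :=
  !![Real.cos θ, -Real.sin θ; Real.sin θ, Real.cos θ]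

/-- The generating kernel rotated by the angle `θ`. The operator `f ↦ f (R_θᵀ x)`, extended from
functions to measures, is the push-forward under `R_θ`. -/
def rotatedKernel (a θ : ℝ) : Measure Plane :=
  (generatingKernel a).map (Matrix.toEuclideanLin (rotationMatrix θ))

/-- The convolution of the `N` kernels of scales `a k` and angles `k π / N`, `k = 0, …, N - 1`
(the Dirac mass at the origin is the unit for convolution). -/
def boxSplineMeasure (N : ℕ) (a : Fin N → ℝ) : Measure Plane :=
  (List.ofFn fun k : Fin N => rotatedKernel (a k) ((k : ℝ) * Real.pi / N)).foldr
    (fun μ ν => Measure.conv μ ν) (Measure.dirac 0)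

/-- The radially-uniform box spline: the density of `boxSplineMeasure N a` with respect to area,
its value at a point being the limit of the averages over shrinking discs (so that it is a
pointwise defined function, equal to the continuous density whenever there is one). -/
def boxSpline (N : ℕ) (a : Fin N → ℝ) (x : Plane) : ℝ :=
  limUnder (𝓝[>] (0 : ℝ)) fun r =>
    (boxSplineMeasure N a).real (Metric.closedBall x r) /
      (volume : Measure Plane).real (Metric.closedBall x r)

/-- The scale vector all of whose `N` components are `σ √(24 / N)`. -/
def scaleVector (σ : ℝ) (N : ℕ) : Fin N → ℝ := fun _ => σ * Real.sqrt (24 / (N : ℝ))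

end

end BoxSpline

namespace BoxSpline

/-! The proof works on the Fourier side. The characteristic function of the convolution is the
product of the factors `sinc (a_k / 2 * coord θ_k ξ)`. Since the angles are equally spaced, the
squared coordinates of `ξ` add up to `N / 2 * ‖ξ‖ ^ 2` (`sum_coord_sq`), so replacing each sinc by
`exp (-t ^ 2 / 6)` gives exactly the isotropic Gaussian for every `N ≥ 2`. The error of this
replacement is O(1/N) at each fixed frequency (`tendsto_uniformCharFun`).

To return to densities, the product needs an integrable bound independent of `N`. Comparing sinc²
with `(1 + (t / 3) ^ 2)⁻¹` and using the concavity of the logarithm gives decay of order `‖ξ‖ ^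
(-3)` for all `N ≥ 6` (`abs_uniformCharFun_le`), so dominated convergence applies in the inversion
integral.

Pointwise values are limits of averages over discs. Two non-parallel directions give absolute
continuity, hence these limits exist almost everywhere; three make the characteristic function
integrable, hence the density is continuous and the limits exist at every point. -/

/-- The point at signed distance `t` from the origin in the direction of angle `θ`. -/
noncomputable def lineMap (θ : ℝ) (t : ℝ) : Plane := !₂[Real.cos θ * t, Real.sin θ * t]

/-- The coordinate of `ξ` in the direction of angle `θ`. -/
noncomputable def coord (θ : ℝ) (ξ : Plane) : ℝ := Real.cos θ * ξ 0 + Real.sin θ * ξ 1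

/-- The uniform distribution on `(-a/2, a/2]`. -/
noncomputable def boxMeasure (a : ℝ) : Measure ℝ :=
  volume.withDensity fun t => ENNReal.ofReal (box a t)

/-! ### Characteristic functions of the kernels and their convolution. -/

lemma continuous_lineMap (θ : ℝ) : Continuous (lineMap θ) := by
  unfold lineMap; fun_prop

@[fun_prop]
lemma continuous_coord (θ : ℝ) : Continuous (coord θ) := by
  unfold coord; fun_prop

lemma inner_lineMap (θ t : ℝ) (ξ : Plane) : inner ℝ (lineMap θ t) ξ = t * coord θ ξ := by
  simp [lineMap, coord, PiLp.inner_apply, Fin.sum_univ_two]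
  ring

lemma boxMeasure_eq (a : ℝ) : boxMeasure a =
    ENNReal.ofReal (1 / a) • volume.restrict (Set.Ioc (-a / 2) (a / 2)) := by
  have : (fun t => ENNReal.ofReal (box a t)) =
      (Set.Ioc (-a / 2) (a / 2)).indicator fun _ => ENNReal.ofReal (1 / a) := by
    ext t
    by_cases h : t ∈ Set.Ioc (-a / 2) (a / 2)
    · rw [Set.indicator_of_mem h, box, if_pos h]
    · rw [Set.indicator_of_notMem h, box, if_neg h, ENNReal.ofReal_zero]
  rw [boxMeasure, this, withDensity_indicator measurableSet_Ioc, withDensity_const]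

lemma isProbabilityMeasure_boxMeasure {a : ℝ} (ha : 0 < a) :
    IsProbabilityMeasure (boxMeasure a) := by
  constructor
  rw [boxMeasure_eq]
  simp only [Measure.smul_apply, Measure.restrict_apply MeasurableSet.univ, Set.univ_inter,
    Real.volume_Ioc, smul_eq_mul]
  rw [← ENNReal.ofReal_mul (by positivity), ← ENNReal.ofReal_one]
  congr 1
  field_simp
  ring

lemma boxMeasure_absolutelyContinuous (a : ℝ) : boxMeasure a ≪ volume :=
  withDensity_absolutelyContinuous _ _

instance (a : ℝ) : SFinite (boxMeasure a) := by unfold boxMeasure; infer_instance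

lemma charFun_boxMeasure {a : ℝ} (ha : 0 < a) (ξ : ℝ) :
    charFun (boxMeasure a) ξ = (Real.sinc (a / 2 * ξ) : ℂ) := by
  have hle : -(a / 2) ≤ a / 2 := by linarith
  rw [charFun_apply_real, boxMeasure_eq, integral_smul_measure, neg_div,
    ← intervalIntegral.integral_of_le hle, ENNReal.toReal_ofReal (by positivity)]
  have h1 := integral_exp_mul_I_eq_sinc (a / 2 * ξ)
  by_cases hξ : ξ = 0
  · subst hξ
    have : (a : ℂ) ≠ 0 := by exact_mod_cast ha.ne'
    simp [this]
  have h2 := intervalIntegral.integral_comp_mul_left (a := -(a / 2)) (b := a / 2)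
    (fun x : ℝ => Complex.exp (x * Complex.I)) hξ
  have h3 : ∀ x : ℝ, (ξ : ℂ) * x * Complex.I = ((ξ * x : ℝ) : ℂ) * Complex.I := by
    intro x; push_cast; ring
  simp_rw [h3]
  rw [h2, show ξ * -(a / 2) = -(a / 2 * ξ) by ring, show ξ * (a / 2) = a / 2 * ξ by ring, h1]
  simp only [Complex.real_smul]
  have : (a : ℂ) ≠ 0 := by exact_mod_cast ha.ne'
  have : (ξ : ℂ) ≠ 0 := by exact_mod_cast hξ
  push_cast
  field_simp

lemma rotatedKernel_eq (a θ : ℝ) : rotatedKernel a θ = (boxMeasure a).map (lineMap θ) := by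
  have h1 : Measurable fun p : ℝ × ℝ => (!₂[p.1, p.2] : Plane) := by
    apply Continuous.measurable; fun_prop
  have h2 : Measurable (Matrix.toEuclideanLin (rotationMatrix θ)) :=
    (LinearMap.continuous_of_finiteDimensional _).measurable
  rw [rotatedKernel, generatingKernel, ← boxMeasure, Measure.prod_dirac,
    Measure.map_map h1 (by fun_prop), Measure.map_map h2 (h1.comp (by fun_prop))]
  congr 1
  ext t i
  fin_cases i <;>
    simp [lineMap, rotationMatrix, Matrix.toLpLin_apply, mul_comm]

lemma isProbabilityMeasure_rotatedKernel {a : ℝ} (ha : 0 < a) (θ : ℝ) :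
    IsProbabilityMeasure (rotatedKernel a θ) := by
  have := isProbabilityMeasure_boxMeasure ha
  rw [rotatedKernel_eq]
  exact Measure.isProbabilityMeasure_map (continuous_lineMap θ).aemeasurable

lemma charFun_rotatedKernel {a : ℝ} (ha : 0 < a) (θ : ℝ) (ξ : Plane) :
    charFun (rotatedKernel a θ) ξ = (Real.sinc (a / 2 * coord θ ξ) : ℂ) := by
  rw [← charFun_boxMeasure ha, rotatedKernel_eq, charFun_apply, charFun_apply_real,
    integral_map (continuous_lineMap θ).aemeasurable (by fun_prop)]
  congr 1 with t
  rw [inner_lineMap]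
  push_cast
  ring_nf

lemma foldr_conv_isProbabilityMeasure {E : Type*} [AddMonoid E] [MeasurableSpace E]
    [MeasurableAdd₂ E] (l : List (Measure E)) (hl : ∀ μ ∈ l, IsProbabilityMeasure μ) :
    IsProbabilityMeasure (l.foldr (fun μ ν => Measure.conv μ ν) (Measure.dirac 0)) := by
  induction l with
  | nil => simpa using Measure.dirac.isProbabilityMeasure
  | cons μ l ih =>
    have := hl μ (by simp)
    have := ih fun ν hν => hl ν (by simp [hν])
    rw [List.foldr_cons]
    infer_instance

lemma charFun_foldr_conv {E : Type*} [NormedAddCommGroup E] [InnerProductSpace ℝ E]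
    [MeasurableSpace E] [BorelSpace E] [SecondCountableTopology E]
    (l : List (Measure E)) (hl : ∀ μ ∈ l, IsProbabilityMeasure μ) (ξ : E) :
    charFun (l.foldr (fun μ ν => Measure.conv μ ν) (Measure.dirac 0)) ξ =
      (l.map fun μ => charFun μ ξ).prod := by
  induction l with
  | nil => simp
  | cons μ l ih =>
    have := hl μ (by simp)
    have hl' : ∀ ν ∈ l, IsProbabilityMeasure ν := fun ν hν => hl ν (by simp [hν])
    have := foldr_conv_isProbabilityMeasure l hl'
    rw [List.foldr_cons, charFun_conv, ih hl', List.map_cons, List.prod_cons]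

lemma isProbabilityMeasure_boxSplineMeasure {N : ℕ} {a : Fin N → ℝ} (ha : ∀ k, 0 < a k) :
    IsProbabilityMeasure (boxSplineMeasure N a) := by
  apply foldr_conv_isProbabilityMeasure
  simp only [List.forall_mem_ofFn_iff]
  exact fun k => isProbabilityMeasure_rotatedKernel (ha k) _

lemma charFun_boxSplineMeasure {N : ℕ} {a : Fin N → ℝ} (ha : ∀ k, 0 < a k) (ξ : Plane) :
    charFun (boxSplineMeasure N a) ξ =
      ((∏ k : Fin N, Real.sinc (a k / 2 * coord (k * Real.pi / N) ξ) : ℝ) : ℂ) := by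
  rw [boxSplineMeasure, charFun_foldr_conv]
  · rw [List.map_ofFn, List.prod_ofFn]
    push_cast
    exact Finset.prod_congr rfl fun k _ => charFun_rotatedKernel (ha k) _ _
  · simp only [List.forall_mem_ofFn_iff]
    exact fun k => isProbabilityMeasure_rotatedKernel (ha k) _

/-! ### Absolute continuity of the convolution. -/

/-- Pushing forward along a linear isomorphism preserves absolute continuity. -/
lemma volume_map_absolutelyContinuous {E F : Type*} [NormedAddCommGroup E] [NormedSpace ℝ E]
    [MeasurableSpace E] [BorelSpace E] [FiniteDimensional ℝ E]
    [NormedAddCommGroup F] [NormedSpace ℝ F] [MeasurableSpace F] [BorelSpace F]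
    [FiniteDimensional ℝ F] (μ : Measure E) [μ.IsAddHaarMeasure] (ν : Measure F)
    [ν.IsAddHaarMeasure] (e : E ≃ₗ[ℝ] F) : μ.map e ≪ ν := by
  have h : (μ.map e.toContinuousLinearEquiv).IsAddHaarMeasure := inferInstance
  exact Measure.absolutelyContinuous_isAddHaarMeasure (μ.map e.toContinuousLinearEquiv) ν

/-- The coordinates in two non-parallel directions form a linear isomorphism. -/
noncomputable def coordEquiv (α β : ℝ) (h : Real.sin (β - α) ≠ 0) : Plane ≃ₗ[ℝ] ℝ × ℝ :=
  LinearEquiv.ofBijective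
    { toFun := fun ξ => (coord α ξ, coord β ξ)
      map_add' := fun x y => by simp [coord]; constructor <;> ring
      map_smul' := fun c x => by simp [coord]; constructor <;> ring } (by
    have hd := Real.sin_sub β α
    constructor
    · rw [← LinearMap.ker_eq_bot, LinearMap.ker_eq_bot']
      intro x hx
      simp only [LinearMap.coe_mk, AddHom.coe_mk, coord, Prod.mk_eq_zero] at hx
      have h0 : Real.sin (β - α) * x 0 = 0 := by
        rw [hd]; linear_combination Real.sin β * hx.1 - Real.sin α * hx.2
      have h1 : Real.sin (β - α) * x 1 = 0 := by
        rw [hd]; linear_combination Real.cos α * hx.2 - Real.cos β * hx.1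
      ext i
      fin_cases i
      · simpa [h] using h0
      · simpa [h] using h1
    · rintro ⟨s, t⟩
      refine ⟨!₂[(Real.sin β * s - Real.sin α * t) / Real.sin (β - α),
        (Real.cos α * t - Real.cos β * s) / Real.sin (β - α)], ?_⟩
      simp only [LinearMap.coe_mk, AddHom.coe_mk, coord, Prod.mk.injEq]
      simp
      constructor <;> field_simp <;> rw [hd] <;> ring)

@[simp]
lemma coordEquiv_apply (α β : ℝ) (h : Real.sin (β - α) ≠ 0) (ξ : Plane) :
    coordEquiv α β h ξ = (coord α ξ, coord β ξ) := rfl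

/-- Adding points on two non-parallel lines is a linear isomorphism from ℝ × ℝ to the plane, and the
convolution is the image under it of an absolutely continuous product measure. -/
lemma conv_rotatedKernel_absolutelyContinuous (a b α β : ℝ) (h : Real.sin (β - α) ≠ 0) :
    Measure.conv (rotatedKernel a α) (rotatedKernel b β) ≪ volume := by
  have hc : Continuous fun p : ℝ × ℝ => lineMap α p.1 + lineMap β p.2 :=
    ((continuous_lineMap α).comp continuous_fst).add ((continuous_lineMap β).comp continuous_snd)
  rw [rotatedKernel_eq, rotatedKernel_eq, Measure.conv,
    Measure.map_prod_map _ _ (continuous_lineMap α).measurable (continuous_lineMap β).measurable,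
    Measure.map_map (by fun_prop) ((continuous_lineMap α).measurable.prodMap
      (continuous_lineMap β).measurable)]
  refine (((boxMeasure_absolutelyContinuous a).prod
    (boxMeasure_absolutelyContinuous b)).map hc.measurable).trans ?_
  let f : ℝ × ℝ →ₗ[ℝ] Plane :=
    { toFun := fun p => lineMap α p.1 + lineMap β p.2
      map_add' := fun x y => by ext i; fin_cases i <;> simp [lineMap] <;> ring
      map_smul' := fun c x => by ext i; fin_cases i <;> simp [lineMap] <;> ring }
  have hf : Function.Surjective f := by
    have hd := Real.sin_sub β α
    intro x
    refine ⟨((Real.sin β * x 0 - Real.cos β * x 1) / Real.sin (β - α),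
      (Real.cos α * x 1 - Real.sin α * x 0) / Real.sin (β - α)), ?_⟩
    ext i
    fin_cases i <;> simp [f, lineMap] <;> field_simp <;> rw [hd] <;> ring
  let e := LinearEquiv.ofBijective f
    ⟨(LinearMap.injective_iff_surjective_of_finrank_eq_finrank (by simp)).2 hf, hf⟩
  exact volume_map_absolutelyContinuous (volume.prod volume) volume e

/-- The first two kernels, at angles 0 and π/N, already convolve to an absolutely continuous
measure, and further convolution preserves this. -/
lemma boxSplineMeasure_absolutelyContinuous {N : ℕ} (hN : 2 ≤ N) {a : Fin N → ℝ}
    (ha : ∀ k, 0 < a k) : boxSplineMeasure N a ≪ volume := by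
  obtain ⟨n, rfl⟩ := Nat.exists_eq_add_of_le' hN
  rw [boxSplineMeasure, List.ofFn_succ, List.ofFn_succ, List.foldr_cons, List.foldr_cons]
  have h0 := isProbabilityMeasure_rotatedKernel (ha 0)
    (((0 : Fin (n + 2)) : ℝ) * Real.pi / (n + 2 : ℕ))
  have h1 := isProbabilityMeasure_rotatedKernel (ha 1)
    (((1 : Fin (n + 2)) : ℝ) * Real.pi / (n + 2 : ℕ))
  set l := List.ofFn fun i : Fin n => rotatedKernel (a i.succ.succ)
    (((i.succ.succ : Fin (n + 2)) : ℝ) * Real.pi / (n + 2 : ℕ)) with hl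
  have h2 := foldr_conv_isProbabilityMeasure l (by
    simp only [hl, List.forall_mem_ofFn_iff]
    exact fun k => isProbabilityMeasure_rotatedKernel (ha _) _)
  rw [show Fin.succ (0 : Fin (n + 1)) = 1 from rfl, ← Measure.conv_assoc, Measure.conv_comm]
  apply Measure.conv_absolutelyContinuous
  apply conv_rotatedKernel_absolutelyContinuous
  apply ne_of_gt
  apply Real.sin_pos_of_pos_of_lt_pi
  · simp; positivity
  · simp
    rw [div_lt_iff₀ (by positivity)]
    nlinarith [Real.pi_pos, n.cast_nonneg (α := ℝ)]

/-! ### Fourier inversion and continuous densities. -/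

open scoped FourierTransform SchwartzMap ContDiff RealInnerProductSpace

section Fourier

variable {V : Type*} [NormedAddCommGroup V] [InnerProductSpace ℝ V] [FiniteDimensional ℝ V]
  [MeasurableSpace V] [BorelSpace V]

/-- The Fourier transform is self-adjoint. -/
lemma integral_fourier_mul_eq {f g : V → ℂ} (hf : Integrable f) (hg : Integrable g) :
    ∫ ξ, 𝓕 f ξ * g ξ = ∫ x, f x * 𝓕 g x := by
  have h := VectorFourier.integral_fourierIntegral_smul_eq_flip (μ := (volume : Measure V))
    (ν := (volume : Measure V)) (L := innerₗ V) (f := f) (g := g)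
    Real.continuous_fourierChar continuous_inner hf hg
  rw [flip_innerₗ] at h
  exact h

/-- The inverse Fourier transform is self-adjoint. -/
lemma integral_fourierInv_mul_eq {f g : V → ℂ} (hf : Integrable f) (hg : Integrable g) :
    ∫ ξ, 𝓕⁻ f ξ * g ξ = ∫ x, f x * 𝓕⁻ g x := by
  rw [Real.fourierInv_eq_fourier_comp_neg, integral_fourier_mul_eq hf.comp_neg hg,
    ← integral_neg_eq_self]
  simp_rw [neg_neg, Real.fourierInv_eq_fourier_neg]

/-- Fourier inversion almost everywhere, without continuity of the function. -/
lemma fourierInv_fourier_ae_eq {f : V → ℂ} (hf : Integrable f) (hf' : Integrable (𝓕 f)) :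
    ∀ᵐ x, 𝓕⁻ (𝓕 f) x = f x := by
  have hc : Continuous (𝓕⁻ (𝓕 f)) := by
    rw [Real.fourierInv_eq_fourier_comp_neg]
    exact VectorFourier.fourierIntegral_continuous Real.continuous_fourierChar
      continuous_inner hf'.comp_neg
  -- Test against smooth compactly supported `g`: self-adjointness moves both transforms onto `g`,
  -- where inversion is known because `g` is Schwartz.
  refine ae_eq_of_integral_contDiff_smul_eq hc.locallyIntegrable hf.locallyIntegrable ?_
  intro g hg hgs
  have hgs' : HasCompactSupport fun x => (g x : ℂ) :=
    hgs.comp_left (g := fun t : ℝ => (t : ℂ)) Complex.ofReal_zero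
  let G : 𝓢(V, ℂ) := hgs'.toSchwartzMap (Complex.ofRealCLM.contDiff.comp hg)
  have hG : ∀ x, G x = (g x : ℂ) := fun x => rfl
  have hF : 𝓕 (𝓕⁻ (G : V → ℂ)) = G := by
    rw [← SchwartzMap.fourierInv_coe, ← SchwartzMap.fourier_coe]
    simp
  have hi : Integrable (𝓕⁻ (G : V → ℂ)) := by
    rw [← SchwartzMap.fourierInv_coe]
    exact (𝓕⁻ G).integrable
  simp_rw [Complex.real_smul, ← hG]
  rw [← integral_fourierInv_mul_eq G.integrable hf', ← integral_fourier_mul_eq hi hf, hF]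

lemma fourier_rnDeriv (μ : Measure V) [IsFiniteMeasure μ] (hμ : μ ≪ volume) (ξ : V) :
    𝓕 (fun x => ((μ.rnDeriv volume x).toReal : ℂ)) ξ = charFun μ (-(2 * Real.pi) • ξ) := by
  rw [Real.fourier_eq', charFun_apply, ← integral_rnDeriv_smul hμ]
  congr 1 with x
  rw [Complex.real_smul, smul_eq_mul, mul_comm, inner_smul_right]
  push_cast
  ring_nf

/-- The continuous density of a measure with integrable characteristic function. -/
noncomputable def fourierDensity (μ : Measure V) (x : V) : ℝ :=
  (𝓕⁻ (fun ξ => charFun μ (-(2 * Real.pi) • ξ)) x).re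

lemma continuous_fourierDensity (μ : Measure V)
    (h : Integrable fun ξ => charFun μ (-(2 * Real.pi) • ξ)) :
    Continuous (fourierDensity μ) := by
  refine Complex.continuous_re.comp ?_
  rw [Real.fourierInv_eq_fourier_comp_neg]
  exact VectorFourier.fourierIntegral_continuous Real.continuous_fourierChar
    continuous_inner h.comp_neg

lemma rnDeriv_ae_eq_fourierDensity (μ : Measure V) [IsFiniteMeasure μ] (hμ : μ ≪ volume)
    (h : Integrable fun ξ => charFun μ (-(2 * Real.pi) • ξ)) :
    ∀ᵐ x, (μ.rnDeriv volume x).toReal = fourierDensity μ x := by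
  have e : 𝓕 (fun x => ((μ.rnDeriv volume x).toReal : ℂ)) =
      fun ξ => charFun μ (-(2 * Real.pi) • ξ) := funext (fourier_rnDeriv μ hμ)
  have := fourierInv_fourier_ae_eq (Measure.integrable_toReal_rnDeriv (μ := μ)
    (ν := volume)).ofReal (e ▸ h)
  filter_upwards [this] with x hx
  rw [fourierDensity, ← e]
  erw [hx]
  simp

end Fourier

/-- The averages of a measure over shrinking balls converge to a continuous version of its
density. -/
lemma tendsto_average_closedBall {V : Type*} [NormedAddCommGroup V] [NormedSpace ℝ V]
    [FiniteDimensional ℝ V] [MeasurableSpace V] [BorelSpace V] {μ ν : Measure V}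
    [IsFiniteMeasure μ] [ν.IsAddHaarMeasure] (hμ : μ ≪ ν) {f : V → ℝ} (hf : Continuous f)
    (h : ∀ᵐ x ∂ν, (μ.rnDeriv ν x).toReal = f x) (x : V) :
    Tendsto (fun r => μ.real (Metric.closedBall x r) / ν.real (Metric.closedBall x r))
      (𝓝[>] 0) (𝓝 (f x)) := by
  have hs : Tendsto (fun r : ℝ => Metric.closedBall x r) (𝓝[>] 0) (𝓝 x).smallSets :=
    (tendsto_closedBall_smallSets x).mono_left nhdsWithin_le_nhds
  have hl := hf.continuousAt.integral_sub_linear_isLittleO_ae (μ := ν) (x := x)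
    hf.stronglyMeasurable.stronglyMeasurableAtFilter hs
  have ht := hl.tendsto_div_nhds_zero.add_const (f x)
  rw [zero_add] at ht
  refine ht.congr' ?_
  filter_upwards [self_mem_nhdsWithin] with r hr
  have hpos : ν.real (Metric.closedBall x r) ≠ 0 := by
    apply ne_of_gt
    exact ENNReal.toReal_pos (Metric.measure_closedBall_pos ν x hr).ne'
      measure_closedBall_lt_top.ne
  rw [← Measure.setIntegral_toReal_rnDeriv hμ, setIntegral_congr_ae (g := f)
    Metric.isClosed_closedBall.measurableSet (h.mono fun y hy _ => hy), smul_eq_mul]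
  field_simp
  ring

/-! ### The disc averages as a density. -/

section BoxSpline

variable {N : ℕ} {a : Fin N → ℝ}

/-- By Besicovitch differentiation the disc averages converge almost everywhere; only there does
`limUnder` carry information. -/
lemma boxSpline_ae_eq_rnDeriv (ha : ∀ k, 0 < a k) :
    ∀ᵐ x, boxSpline N a x = ((boxSplineMeasure N a).rnDeriv volume x).toReal := by
  have := isProbabilityMeasure_boxSplineMeasure ha
  filter_upwards [Besicovitch.ae_tendsto_rnDeriv (boxSplineMeasure N a) volume,
    (boxSplineMeasure N a).rnDeriv_lt_top volume] with x hx hx'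
  have h := (ENNReal.tendsto_toReal hx'.ne).comp hx
  simp_rw [Function.comp_def, ENNReal.toReal_div] at h
  exact h.limUnder_eq

lemma boxSpline_ae_nonneg (ha : ∀ k, 0 < a k) :
    ∀ᵐ x, 0 ≤ boxSpline N a x := by
  filter_upwards [boxSpline_ae_eq_rnDeriv ha] with x hx
  rw [hx]
  exact ENNReal.toReal_nonneg

lemma boxSplineMeasure_eq_withDensity (hN : 2 ≤ N) (ha : ∀ k, 0 < a k) :
    boxSplineMeasure N a = volume.withDensity fun x => ENNReal.ofReal (boxSpline N a x) := by
  have := isProbabilityMeasure_boxSplineMeasure ha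
  refine (Measure.withDensity_rnDeriv_eq (boxSplineMeasure N a) volume
    (boxSplineMeasure_absolutelyContinuous hN ha)).symm.trans ?_
  apply withDensity_congr_ae
  filter_upwards [boxSpline_ae_eq_rnDeriv ha,
    (boxSplineMeasure N a).rnDeriv_lt_top volume] with x hx hx'
  rw [hx, ENNReal.ofReal_toReal hx'.ne]

lemma boxSpline_eq_fourierDensity (hN : 2 ≤ N) (ha : ∀ k, 0 < a k)
    (h : Integrable fun ξ => charFun (boxSplineMeasure N a) (-(2 * Real.pi) • ξ)) :
    boxSpline N a = fourierDensity (boxSplineMeasure N a) := by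
  have := isProbabilityMeasure_boxSplineMeasure ha
  have hac := boxSplineMeasure_absolutelyContinuous hN ha
  ext x
  exact (tendsto_average_closedBall hac (continuous_fourierDensity _ h)
    (rnDeriv_ae_eq_fourierDensity _ hac h) x).limUnder_eq

end BoxSpline

/-! ### Estimates for sinc. -/

section Sinc

lemma abs_sinc_sub_le {t : ℝ} (ht : |t| ≤ 1) : |Real.sinc t - (1 - t ^ 2 / 6)| ≤ t ^ 4 / 100 := by
  by_cases h0 : t = 0
  · simp [h0]
  have h := Real.sin_bound ht
  rw [Real.sinc_of_ne_zero h0,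
    show Real.sin t / t - (1 - t ^ 2 / 6) = (Real.sin t - (t - t ^ 3 / 6)) / t by field_simp,
    abs_div, div_le_iff₀ (abs_pos.mpr h0)]
  refine h.trans_eq ?_
  rw [← (show Even 4 by decide).pow_abs t]
  ring

lemma abs_sinc_sub_exp_le {t : ℝ} (ht : |t| ≤ 1) :
    |Real.sinc t - Real.exp (-t ^ 2 / 6)| ≤ t ^ 4 := by
  have h2 : t ^ 2 ≤ 1 := (sq_le_one_iff_abs_le_one t).mpr ht
  have h1 := abs_sinc_sub_le ht
  have h3 : |Real.exp (-t ^ 2 / 6) - 1 - -t ^ 2 / 6| ≤ (-t ^ 2 / 6) ^ 2 :=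
    Real.abs_exp_sub_one_sub_id_le (by rw [abs_le]; constructor <;> nlinarith [sq_nonneg t])
  rw [abs_le] at *
  have : 0 ≤ t ^ 4 := by positivity
  constructor <;> nlinarith

/-- The reciprocal form lets a product of such bounds be estimated by Bernoulli's inequality. Near 0
it follows from the Taylor bound, and from sin² ≤ 1 once t² ≥ 9/8. -/
lemma sinc_sq_le (t : ℝ) : Real.sinc t ^ 2 ≤ (1 + (t / 3) ^ 2)⁻¹ := by
  rw [← one_div, le_div_iff₀ (by positivity)]
  rcases le_or_gt |t| 1 with ht | ht
  · have h2 : t ^ 2 ≤ 1 := (sq_le_one_iff_abs_le_one t).mpr ht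
    have h0 : 0 ≤ t ^ 2 := sq_nonneg t
    have h := abs_le.mp (abs_sinc_sub_le ht)
    have h4 : t ^ 4 ≤ t ^ 2 := by nlinarith
    have hl : 0 ≤ Real.sinc t := by linarith [h.1]
    have hu : Real.sinc t ≤ 1 - t ^ 2 / 9 := by linarith [h.2]
    calc Real.sinc t ^ 2 * (1 + (t / 3) ^ 2)
        ≤ (1 - t ^ 2 / 9) ^ 2 * (1 + (t / 3) ^ 2) := by gcongr
      _ ≤ 1 := by nlinarith [mul_nonneg h0 h0, mul_nonneg h0 (mul_nonneg h0 h0)]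
  · have h1 : 1 < t ^ 2 := (one_lt_sq_iff_one_lt_abs t).mpr ht
    have h0 : t ≠ 0 := by rintro rfl; norm_num at ht
    rw [Real.sinc_of_ne_zero h0, div_pow, div_mul_eq_mul_div, div_le_one (by positivity)]
    have hs := Real.sin_sq_le_one t
    rcases le_or_gt (9 / 8) (t ^ 2) with h2 | h2
    · nlinarith [mul_le_mul_of_nonneg_right hs (show 0 ≤ 1 + (t / 3) ^ 2 by positivity)]
    -- On 1 < t² < 9/8 the bound sin² ≤ 1 is too weak; cos t ≥ 1 - t²/2 improves it to sin² ≤ 1 -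
    -- (7/16)².
    · have hc : 7 / 16 ≤ Real.cos t := by linarith [Real.one_sub_sq_div_two_le_cos (x := t)]
      have hs' : Real.sin t ^ 2 ≤ 207 / 256 := by nlinarith [Real.sin_sq_add_cos_sq t]
      nlinarith [mul_le_mul_of_nonneg_right hs' (show 0 ≤ 1 + (t / 3) ^ 2 by positivity)]

/-- Written as a square so that a product of three bounds splits as p²q²r² = (pq)(qr)(pr), a product
of pairwise terms. -/
lemma abs_sinc_le_rpow (t : ℝ) :
    |Real.sinc t| ≤ ((1 + (t / 3) ^ 2) ^ (-(1 / 4) : ℝ)) ^ 2 := by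
  have h : (((1 + (t / 3) ^ 2) ^ (-(1 / 4) : ℝ)) ^ 2) ^ 2 = (1 + (t / 3) ^ 2)⁻¹ := by
    rw [← pow_mul, ← Real.rpow_natCast, ← Real.rpow_mul (by positivity), ← Real.rpow_neg_one]
    norm_num
  refine abs_le_of_sq_le_sq ?_ (by positivity)
  rw [h]
  exact sinc_sq_le t

end Sinc

/-! ### Inequalities for products. -/

lemma abs_prod_sub_prod_le {ι : Type*} (s : Finset ι) {f g : ι → ℝ} (hf : ∀ i, |f i| ≤ 1)
    (hg : ∀ i, |g i| ≤ 1) : |∏ i ∈ s, f i - ∏ i ∈ s, g i| ≤ ∑ i ∈ s, |f i - g i| := by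
  classical
  induction s using Finset.induction_on with
  | empty => simp
  | insert i s hi ih =>
    rw [Finset.prod_insert hi, Finset.prod_insert hi, Finset.sum_insert hi]
    have hgs : |∏ i ∈ s, g i| ≤ 1 := by
      rw [Finset.abs_prod]
      exact Finset.prod_le_one (fun _ _ => abs_nonneg _) fun i _ => hg i
    calc |f i * ∏ i ∈ s, f i - g i * ∏ i ∈ s, g i|
        = |f i * (∏ i ∈ s, f i - ∏ i ∈ s, g i) + (f i - g i) * ∏ i ∈ s, g i| := by ring_nf
      _ ≤ |f i| * |∏ i ∈ s, f i - ∏ i ∈ s, g i| + |f i - g i| * |∏ i ∈ s, g i| := by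
        rw [← abs_mul, ← abs_mul]; exact abs_add_le _ _
      _ ≤ 1 * |∏ i ∈ s, f i - ∏ i ∈ s, g i| + |f i - g i| * 1 := by
        gcongr; exact hf i
      _ ≤ |f i - g i| + ∑ i ∈ s, |f i - g i| := by linarith

/-- By concavity log (1 + y) lies above its chord on [0, M]; the inequality is this, summed over the
factors and exponentiated. -/
lemma one_add_rpow_sum_div_le_prod {ι : Type*} (s : Finset ι) {y : ι → ℝ} {M : ℝ} (hM : 0 < M)
    (h0 : ∀ i, 0 ≤ y i) (h1 : ∀ i, y i ≤ M) :
    (1 + M) ^ ((∑ i ∈ s, y i) / M) ≤ ∏ i ∈ s, (1 + y i) := by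
  rw [Finset.sum_div, Real.rpow_sum_of_pos (by positivity)]
  refine Finset.prod_le_prod (fun i _ => by positivity) fun i _ => ?_
  have := rpow_one_add_le_one_add_mul_self (s := M) (p := y i / M) (by linarith)
    (div_nonneg (h0 i) hM.le) ((div_le_one hM).mpr (h1 i))
  rwa [div_mul_cancel₀ _ hM.ne'] at this

/-! ### Equally spaced directions. -/

lemma norm_sq_eq (ξ : Plane) : ‖ξ‖ ^ 2 = ξ 0 ^ 2 + ξ 1 ^ 2 := by
  simp [EuclideanSpace.norm_sq_eq, Fin.sum_univ_two]

lemma coord_sq_le (θ : ℝ) (ξ : Plane) : coord θ ξ ^ 2 ≤ ‖ξ‖ ^ 2 := by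
  rw [norm_sq_eq, coord]
  have := Real.sin_sq_add_cos_sq θ
  have h : ξ 0 ^ 2 + ξ 1 ^ 2 - (Real.cos θ * ξ 0 + Real.sin θ * ξ 1) ^ 2 =
    (Real.sin θ * ξ 0 - Real.cos θ * ξ 1) ^ 2 := by
    linear_combination (-(ξ 0 ^ 2) - ξ 1 ^ 2) * this
  nlinarith [sq_nonneg (Real.sin θ * ξ 0 - Real.cos θ * ξ 1)]

lemma sum_exp_roots_of_unity {N : ℕ} (hN : 2 ≤ N) :
    ∑ k : Fin N, Complex.exp (((2 * (k * Real.pi / N) : ℝ) : ℂ) * Complex.I) = 0 := by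
  have h := (Complex.isPrimitiveRoot_exp N (by omega)).geom_sum_eq_zero (by omega)
  rw [← h, ← Fin.sum_univ_eq_sum_range fun k => Complex.exp (2 * Real.pi * Complex.I / N) ^ k]
  refine Finset.sum_congr rfl fun k _ => ?_
  rw [← Complex.exp_nat_mul]
  push_cast
  ring_nf

/-- The double-angle terms sum to zero, as real and imaginary parts of a sum of roots of unity; this
is the source of isotropy. -/
lemma sum_coord_sq {N : ℕ} (hN : 2 ≤ N) (ξ : Plane) :
    ∑ k : Fin N, coord (k * Real.pi / N) ξ ^ 2 = N / 2 * ‖ξ‖ ^ 2 := by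
  have h := sum_exp_roots_of_unity hN
  have hc : ∑ k : Fin N, Real.cos (2 * (k * Real.pi / N)) = 0 := by
    simpa only [Complex.re_sum, Complex.exp_ofReal_mul_I_re, Complex.zero_re]
      using congrArg Complex.re h
  have hs : ∑ k : Fin N, Real.sin (2 * (k * Real.pi / N)) = 0 := by
    simpa only [Complex.im_sum, Complex.exp_ofReal_mul_I_im, Complex.zero_im]
      using congrArg Complex.im h
  have he : ∀ θ, coord θ ξ ^ 2 = ‖ξ‖ ^ 2 / 2 + Real.cos (2 * θ) * ((ξ 0 ^ 2 - ξ 1 ^ 2) / 2) +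
      Real.sin (2 * θ) * (ξ 0 * ξ 1) := by
    intro θ
    rw [norm_sq_eq, coord, Real.cos_two_mul, Real.sin_two_mul]
    linear_combination (ξ 1) ^ 2 * Real.sin_sq_add_cos_sq θ
  simp_rw [he, Finset.sum_add_distrib, ← Finset.sum_mul, hc, hs]
  simp
  ring

/-! ### Integrability of the characteristic function. -/

/-- Integrability of a function composed with a linear isomorphism. -/
lemma integrable_comp_linearEquiv {E F G : Type*} [NormedAddCommGroup E] [NormedSpace ℝ E]
    [MeasurableSpace E] [BorelSpace E] [FiniteDimensional ℝ E]
    [NormedAddCommGroup F] [NormedSpace ℝ F] [MeasurableSpace F] [BorelSpace F]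
    [FiniteDimensional ℝ F] [NormedAddCommGroup G] {μ : Measure E} [μ.IsAddHaarMeasure]
    {ν : Measure F} [ν.IsAddHaarMeasure] (e : E ≃ₗ[ℝ] F) {f : F → G} (hf : Integrable f ν) :
    Integrable (fun x => f (e x)) μ := by
  let e' := e.toContinuousLinearEquiv.toHomeomorph.toMeasurableEquiv
  have h : (μ.map e.toContinuousLinearEquiv).IsAddHaarMeasure := inferInstance
  have hi : Integrable f (μ.map e.toContinuousLinearEquiv) := by
    rw [Measure.isAddLeftInvariant_eq_smul (μ.map e.toContinuousLinearEquiv) ν]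
    exact hf.smul_measure ENNReal.coe_ne_top
  exact (integrable_map_equiv e' f).mp hi

lemma integrable_one_add_sq_rpow {c : ℝ} (hc : c ≠ 0) :
    Integrable fun t : ℝ => ((1 + (c * t / 3) ^ 2) ^ (-(1 / 4) : ℝ)) ^ 3 := by
  have h := (integrable_rpow_neg_one_add_norm_sq (E := ℝ) (μ := volume) (r := 3 / 2)
    (by norm_num)).comp_mul_left' (R := c / 3) (by positivity)
  refine h.congr (Eventually.of_forall fun t => ?_)
  simp only [Real.norm_eq_abs, sq_abs]
  rw [← Real.rpow_natCast _ 3, ← Real.rpow_mul (by positivity)]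
  norm_num
  ring_nf

lemma integrable_coord_mul_coord {f g : ℝ → ℝ} (hf : Integrable f) (hg : Integrable g)
    {α β : ℝ} (h : Real.sin (β - α) ≠ 0) :
    Integrable fun ξ => f (coord α ξ) * g (coord β ξ) :=
  integrable_comp_linearEquiv (ν := (volume : Measure ℝ).prod volume) (coordEquiv α β h)
    (hf.mul_prod hg)

lemma mul_mul_le_sum_cubes {p q r : ℝ} (hp : 0 ≤ p) (hq : 0 ≤ q) (hr : 0 ≤ r) :
    p * q * r ≤ p ^ 3 + q ^ 3 + r ^ 3 := by
  nlinarith [mul_nonneg (add_nonneg (add_nonneg hp hq) hr)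
    (add_nonneg (add_nonneg (sq_nonneg (p - q)) (sq_nonneg (q - r))) (sq_nonneg (p - r))),
    pow_nonneg hp 3, pow_nonneg hq 3, pow_nonneg hr 3]

/-- Single sincs are not absolutely integrable, so two directions do not suffice. With three, the
product is at most a sum of cubes of pairwise products, and each cube is integrable in two
independent coordinates, since its one-variable factors decay like |t|^(-3/2). -/
lemma integrable_sinc_mul_sinc_mul_sinc {a b c α β γ : ℝ} (ha : a ≠ 0) (hb : b ≠ 0) (hc : c ≠ 0)
    (h1 : Real.sin (β - α) ≠ 0) (h2 : Real.sin (γ - β) ≠ 0) (h3 : Real.sin (γ - α) ≠ 0) :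
    Integrable fun ξ : Plane => Real.sinc (a * coord α ξ) * Real.sinc (b * coord β ξ) *
      Real.sinc (c * coord γ ξ) := by
  have ia := integrable_one_add_sq_rpow ha
  have ib := integrable_one_add_sq_rpow hb
  have ic := integrable_one_add_sq_rpow hc
  have cs := Real.continuous_sinc
  refine (((integrable_coord_mul_coord ia ib h1).add (integrable_coord_mul_coord ib ic h2)).add
    (integrable_coord_mul_coord ia ic h3)).mono' (by fun_prop) (Eventually.of_forall fun ξ => ?_)
  simp only [Real.norm_eq_abs, abs_mul, Pi.add_apply, ← mul_pow]
  refine (mul_le_mul (mul_le_mul (abs_sinc_le_rpow _) (abs_sinc_le_rpow _) (abs_nonneg _)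
    (by positivity)) (abs_sinc_le_rpow _) (abs_nonneg _) (by positivity)).trans ?_
  refine le_trans (le_of_eq ?_) (mul_mul_le_sum_cubes (by positivity) (by positivity)
    (by positivity))
  ring

lemma integrable_prod_sinc {N : ℕ} (hN : 3 ≤ N) {c : Fin N → ℝ} (hc : ∀ k, c k ≠ 0) :
    Integrable fun ξ : Plane => ∏ k : Fin N, Real.sinc (c k * coord (k * Real.pi / N) ξ) := by
  obtain ⟨n, rfl⟩ := Nat.exists_eq_add_of_le' hN
  have cs := Real.continuous_sinc
  have hsin : ∀ i j : Fin (n + 3), i < j →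
      Real.sin (j * Real.pi / (n + 3 : ℕ) - i * Real.pi / (n + 3 : ℕ)) ≠ 0 := by
    intro i j hij
    have h1 : (i : ℝ) < j := by exact_mod_cast hij
    have h2 : (j : ℝ) < (n + 3 : ℕ) := by exact_mod_cast j.2
    have h3 : (0 : ℝ) ≤ (i : ℕ) := Nat.cast_nonneg _
    have h4 : (0 : ℝ) < (n + 3 : ℕ) := by positivity
    rw [← sub_div, ← sub_mul]
    apply ne_of_gt
    apply Real.sin_pos_of_pos_of_lt_pi
    · have : (0 : ℝ) < (j : ℝ) - i := by linarith
      positivity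
    · rw [div_lt_iff₀ h4, mul_comm]
      exact mul_lt_mul_of_pos_left (by linarith) Real.pi_pos
  have h01 : (0 : Fin (n + 3)) < (0 : Fin (n + 2)).succ := Fin.succ_pos _
  have h12 : (0 : Fin (n + 2)).succ < (0 : Fin (n + 1)).succ.succ :=
    Fin.succ_lt_succ_iff.mpr (Fin.succ_pos _)
  refine (integrable_sinc_mul_sinc_mul_sinc (hc 0) (hc (Fin.succ 0)) (hc (Fin.succ (Fin.succ 0)))
    (hsin _ _ h01)
    (hsin _ _ h12) (hsin _ _ (h01.trans h12))).mono (by fun_prop)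
      (Eventually.of_forall fun ξ => ?_)
  rw [Fin.prod_univ_succ, Fin.prod_univ_succ, Fin.prod_univ_succ, ← mul_assoc, ← mul_assoc,
    norm_mul]
  refine mul_le_of_le_one_right (norm_nonneg _) ?_
  rw [Real.norm_eq_abs, Finset.abs_prod]
  exact Finset.prod_le_one (fun _ _ => abs_nonneg _) fun _ _ => Real.abs_sinc_le_one _

/-! ### Equal scales: uniform bound and pointwise limit. -/

/-- The characteristic function of the box spline of order `N` with all scales `σ √(24 / N)`. -/
noncomputable def uniformCharFun (σ : ℝ) (N : ℕ) (ξ : Plane) : ℝ :=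
  ∏ k : Fin N, Real.sinc (σ * Real.sqrt (24 / N) / 2 * coord (k * Real.pi / N) ξ)

lemma scaleVector_pos {σ : ℝ} (hσ : 0 < σ) {N : ℕ} (k : Fin N) : 0 < scaleVector σ N k := by
  have : (0 : ℝ) < N := by exact_mod_cast k.pos
  unfold scaleVector
  positivity

lemma charFun_boxSplineMeasure_scaleVector {σ : ℝ} (hσ : 0 < σ) {N : ℕ} (ξ : Plane) :
    charFun (boxSplineMeasure N (scaleVector σ N)) ξ = (uniformCharFun σ N ξ : ℂ) :=
  charFun_boxSplineMeasure (scaleVector_pos hσ) ξ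

lemma integrable_uniformCharFun {σ : ℝ} (hσ : 0 < σ) {N : ℕ} (hN : 3 ≤ N) :
    Integrable (uniformCharFun σ N) :=
  integrable_prod_sinc hN fun k => (half_pos (scaleVector_pos hσ k)).ne'

lemma integrable_charFun_boxSplineMeasure {σ : ℝ} (hσ : 0 < σ) {N : ℕ}
    (hN : 3 ≤ N) :
    Integrable fun ξ => charFun (boxSplineMeasure N (scaleVector σ N)) (-(2 * Real.pi) • ξ) := by
  simp_rw [charFun_boxSplineMeasure_scaleVector hσ]
  exact ((integrable_uniformCharFun hσ hN).comp_smul (by simp [Real.pi_ne_zero])).ofReal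

lemma boxSpline_eq_fourierInv {σ : ℝ} (hσ : 0 < σ) {N : ℕ}
    (hN : 3 ≤ N) (x : Plane) :
    boxSpline N (scaleVector σ N) x =
      (𝓕⁻ (fun ξ : Plane => (uniformCharFun σ N (-(2 * Real.pi) • ξ) : ℂ)) x).re := by
  rw [boxSpline_eq_fourierDensity (by omega) (scaleVector_pos hσ)
    (integrable_charFun_boxSplineMeasure hσ hN), fourierDensity]
  simp_rw [charFun_boxSplineMeasure_scaleVector hσ]

lemma continuous_boxSpline {σ : ℝ} (hσ : 0 < σ) {N : ℕ}
    (hN : 3 ≤ N) : Continuous (boxSpline N (scaleVector σ N)) := by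
  have h := integrable_charFun_boxSplineMeasure hσ hN
  rw [boxSpline_eq_fourierDensity (by omega) (scaleVector_pos hσ) h]
  exact continuous_fourierDensity _ h

lemma scale_mul_coord_sq (σ θ : ℝ) (N : ℕ) (ξ : Plane) :
    (σ * Real.sqrt (24 / N) / 2 * coord θ ξ) ^ 2 = 6 * σ ^ 2 / N * coord θ ξ ^ 2 := by
  rw [mul_pow, div_pow, mul_pow, Real.sq_sqrt (by positivity)]
  ring

lemma scale_mul_coord_sq_le (σ θ : ℝ) (N : ℕ) (ξ : Plane) :
    (σ * Real.sqrt (24 / N) / 2 * coord θ ξ) ^ 2 ≤ 6 * σ ^ 2 / N * ‖ξ‖ ^ 2 := by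
  rw [scale_mul_coord_sq]
  exact mul_le_mul_of_nonneg_left (coord_sq_le θ ξ) (by positivity)

lemma sum_scale_mul_coord_sq (σ : ℝ) {N : ℕ} (hN : 2 ≤ N) (ξ : Plane) :
    ∑ k : Fin N, (σ * Real.sqrt (24 / N) / 2 * coord (k * Real.pi / N) ξ) ^ 2 =
      3 * σ ^ 2 * ‖ξ‖ ^ 2 := by
  simp_rw [scale_mul_coord_sq, ← Finset.mul_sum, sum_coord_sq hN]
  have : (N : ℝ) ≠ 0 := by positivity
  field_simp
  ring

/-- The dominating function for the limit. With S = ‖(σ/3)ξ‖², the terms y_k = (t_k/3)² are at most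
6S/N and sum to 3S, so the squared product is at most (1 + 6S/N)^(-N/2) ≤ (1 + S)^(-3). -/
lemma abs_uniformCharFun_le {σ : ℝ} (hσ : 0 < σ) {N : ℕ} (hN : 6 ≤ N) (ξ : Plane) :
    |uniformCharFun σ N ξ| ≤ (1 + ‖(σ / 3) • ξ‖ ^ 2) ^ (-3 / 2 : ℝ) := by
  by_cases hξ : ξ = 0
  · subst hξ
    simp [uniformCharFun, coord]
  have hN0 : (0 : ℝ) < N := by positivity
  have hN6 : (6 : ℝ) ≤ N := by exact_mod_cast hN
  have hn : 0 < ‖ξ‖ := norm_pos_iff.mpr hξ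
  set t : Fin N → ℝ := fun k => σ * Real.sqrt (24 / N) / 2 * coord (k * Real.pi / N) ξ with ht
  set S : ℝ := ‖(σ / 3) • ξ‖ ^ 2 with hS
  have hS' : S = σ ^ 2 / 9 * ‖ξ‖ ^ 2 := by
    rw [hS, norm_smul, mul_pow, Real.norm_eq_abs, sq_abs]; ring
  have hSpos : 0 < S := by rw [hS']; positivity
  have hM : 0 < 6 * S / N := by positivity
  have hle : ∀ k, (t k / 3) ^ 2 ≤ 6 * S / N := fun k => by
    have := scale_mul_coord_sq_le σ (k * Real.pi / N) N ξ
    rw [div_pow, hS']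
    calc t k ^ 2 / 3 ^ 2 ≤ (6 * σ ^ 2 / N * ‖ξ‖ ^ 2) / 3 ^ 2 := by gcongr
      _ = _ := by ring
  have hsum : (∑ k, (t k / 3) ^ 2) / (6 * S / N) = N / 2 := by
    simp_rw [div_pow, ← Finset.sum_div]
    rw [ht, sum_scale_mul_coord_sq σ (by omega), hS']
    field_simp
    norm_num
  have hprod := one_add_rpow_sum_div_le_prod Finset.univ hM (fun k => sq_nonneg (t k / 3)) hle
  rw [hsum] at hprod
  have hbern : (1 + S) ^ 3 ≤ (1 + 6 * S / N) ^ (N / 2 : ℝ) := by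
    -- Bernoulli needs the exponent N/6 to be at least 1, whence `6 ≤ N`; cubing turns N/6 into N/2.
    have h := one_add_mul_self_le_rpow_one_add (s := 6 * S / N) (by linarith)
      (p := N / 6) (by linarith)
    rw [show (N / 6 : ℝ) * (6 * S / N) = S by field_simp] at h
    calc (1 + S) ^ 3 ≤ ((1 + 6 * S / N) ^ (N / 6 : ℝ)) ^ 3 := by gcongr
      _ = _ := by
        rw [← Real.rpow_natCast, ← Real.rpow_mul (by positivity)]
        congr 1
        push_cast
        ring
  have hsq : uniformCharFun σ N ξ ^ 2 ≤ ((1 + S) ^ 3)⁻¹ := by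
    rw [uniformCharFun, ← Finset.prod_pow]
    calc ∏ k, Real.sinc (t k) ^ 2 ≤ ∏ k, (1 + (t k / 3) ^ 2)⁻¹ :=
          Finset.prod_le_prod (fun _ _ => sq_nonneg _) fun _ _ => sinc_sq_le _
      _ = (∏ k, (1 + (t k / 3) ^ 2))⁻¹ := by rw [Finset.prod_inv_distrib]
      _ ≤ ((1 + S) ^ 3)⁻¹ := by gcongr; exact hbern.trans hprod
  refine abs_le_of_sq_le_sq ?_ (by positivity)
  refine hsq.trans_eq ?_
  rw [← Real.rpow_natCast _ 2, ← Real.rpow_mul (by positivity), ← Real.rpow_natCast,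
    ← Real.rpow_neg (by positivity)]
  norm_num

/-- Each of the N factors differs from its Gaussian counterpart by at most t_k⁴ ≤ (C/N)², so the
products differ by at most C²/N. -/
lemma tendsto_uniformCharFun (σ : ℝ) (ξ : Plane) :
    Tendsto (fun N => uniformCharFun σ N ξ) atTop (𝓝 (Real.exp (-(σ ^ 2 * ‖ξ‖ ^ 2) / 2))) := by
  set C : ℝ := 6 * σ ^ 2 * ‖ξ‖ ^ 2 with hC
  have hlim : Tendsto (fun N : ℕ => C / N) atTop (𝓝 0) := tendsto_const_div_atTop_nhds_zero_nat C
  rw [tendsto_iff_dist_tendsto_zero]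
  refine squeeze_zero' (Eventually.of_forall fun _ => dist_nonneg) ?_
    (by simpa using hlim.const_mul C : Tendsto (fun N : ℕ => C * (C / N)) atTop (𝓝 0))
  filter_upwards [eventually_ge_atTop 2, hlim.eventually_le_const one_pos] with N hN hN1
  have hN0 : (0 : ℝ) < N := by positivity
  set t : Fin N → ℝ := fun k => σ * Real.sqrt (24 / N) / 2 * coord (k * Real.pi / N) ξ with ht
  have hle : ∀ k, t k ^ 2 ≤ C / N := fun k =>
    (scale_mul_coord_sq_le σ (k * Real.pi / N) N ξ).trans_eq (by rw [hC]; ring)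
  have hexp : Real.exp (-(σ ^ 2 * ‖ξ‖ ^ 2) / 2) = ∏ k, Real.exp (-t k ^ 2 / 6) := by
    rw [← Real.exp_sum, ← Finset.sum_div, Finset.sum_neg_distrib, ht,
      sum_scale_mul_coord_sq σ hN]
    ring_nf
  rw [Real.dist_eq, hexp, uniformCharFun]
  calc |∏ k, Real.sinc (t k) - ∏ k, Real.exp (-t k ^ 2 / 6)|
      ≤ ∑ k, |Real.sinc (t k) - Real.exp (-t k ^ 2 / 6)| := by
        refine abs_prod_sub_prod_le _ (fun k => Real.abs_sinc_le_one _) fun k => ?_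
        rw [Real.abs_exp, Real.exp_le_one_iff]
        have := sq_nonneg (t k)
        linarith
    _ ≤ ∑ k : Fin N, (C / N) ^ 2 := by
        refine Finset.sum_le_sum fun k _ => ?_
        refine (abs_sinc_sub_exp_le ((sq_le_one_iff_abs_le_one _).mp ((hle k).trans hN1))).trans ?_
        calc t k ^ 4 = (t k ^ 2) ^ 2 := by ring
          _ ≤ (C / N) ^ 2 := by gcongr; exact hle k
    _ = C * (C / N) := by
        simp
        field_simp

/-! ### The Gaussian limit. -/

lemma fourierInv_gaussian {σ : ℝ} (hσ : 0 < σ) (x : Plane) :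
    𝓕⁻ (fun ξ : Plane =>
        (Real.exp (-(σ ^ 2 * ‖-(2 * Real.pi) • ξ‖ ^ 2) / 2) : ℂ)) x =
      ((1 / (2 * Real.pi * σ ^ 2) * Real.exp (-‖x‖ ^ 2 / (2 * σ ^ 2)) : ℝ) : ℂ) := by
  have hb : 0 < ((2 * Real.pi ^ 2 * σ ^ 2 : ℝ) : ℂ).re := by
    rw [Complex.ofReal_re]; positivity
  have h := fourier_gaussian_innerProductSpace hb (-x)
  rw [Real.fourierInv_eq_fourier_neg]
  have he : (fun ξ : Plane => (Real.exp (-(σ ^ 2 * ‖-(2 * Real.pi) • ξ‖ ^ 2) / 2) : ℂ)) =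
      fun ξ : Plane => Complex.exp (-((2 * Real.pi ^ 2 * σ ^ 2 : ℝ) : ℂ) * ‖ξ‖ ^ 2) := by
    ext ξ
    rw [norm_smul, norm_neg, Real.norm_of_nonneg (by positivity)]
    push_cast
    ring_nf
  rw [he, h]
  have hσ' : (σ : ℂ) ≠ 0 := by exact_mod_cast hσ.ne'
  have hπ : (Real.pi : ℂ) ≠ 0 := by exact_mod_cast Real.pi_ne_zero
  simp only [finrank_euclideanSpace, Fintype.card_fin, norm_neg]
  push_cast
  -- The exponent dim/2 of the Gaussian prefactor is 1 in the plane.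
  rw [div_self two_ne_zero, Complex.cpow_one]
  congr 1
  · field_simp
  · congr 1
    field_simp

lemma tendsto_boxSpline {σ : ℝ} (hσ : 0 < σ) (x : Plane) :
    Tendsto (fun N : ℕ => boxSpline N (scaleVector σ N) x) atTop
      (𝓝 (1 / (2 * Real.pi * σ ^ 2) * Real.exp (-‖x‖ ^ 2 / (2 * σ ^ 2)))) := by
  have key : Tendsto (fun N : ℕ =>
      𝓕⁻ (fun ξ : Plane => (uniformCharFun σ N (-(2 * Real.pi) • ξ) : ℂ)) x) atTop
      (𝓝 (𝓕⁻ (fun ξ : Plane =>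
        (Real.exp (-(σ ^ 2 * ‖-(2 * Real.pi) • ξ‖ ^ 2) / 2) : ℂ)) x)) := by
    simp only [Real.fourierInv_eq]
    have hbound : Integrable fun ξ : Plane =>
        (1 + ‖(σ / 3) • (-(2 * Real.pi) • ξ)‖ ^ 2) ^ (-3 / 2 : ℝ) := by
      -- The decay exponent 3 exceeds the dimension 2.
      have h := integrable_rpow_neg_one_add_norm_sq (E := Plane) (μ := volume) (r := 3)
        (by simp; norm_num)
      exact (h.comp_smul (R := σ / 3) (by positivity)).comp_smul (by simp [Real.pi_ne_zero])
    refine tendsto_integral_filter_of_dominated_convergence _ ?_ ?_ hbound ?_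
    · filter_upwards [eventually_ge_atTop 3] with N hN
      have hi : Integrable fun ξ : Plane => (uniformCharFun σ N (-(2 * Real.pi) • ξ) : ℂ) :=
        ((integrable_uniformCharFun hσ hN).comp_smul (by simp [Real.pi_ne_zero])).ofReal
      have hcont : Continuous fun ξ : Plane => Real.fourierChar (inner ℝ ξ x) :=
        Real.continuous_fourierChar.comp (by fun_prop)
      exact hcont.aestronglyMeasurable.smul hi.aestronglyMeasurable
    · filter_upwards [eventually_ge_atTop 6] with N hN
      refine Eventually.of_forall fun ξ => ?_
      rw [Circle.norm_smul, Complex.norm_real]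
      exact abs_uniformCharFun_le hσ hN _
    · refine Eventually.of_forall fun ξ => Tendsto.const_smul ?_ _
      exact (Complex.continuous_ofReal.tendsto _).comp (tendsto_uniformCharFun σ _)
  rw [fourierInv_gaussian hσ] at key
  have := (Complex.continuous_re.tendsto _).comp key
  rw [Complex.ofReal_re] at this
  refine this.congr' ?_
  filter_upwards [eventually_ge_atTop 3] with N hN
  exact (boxSpline_eq_fourierInv hσ hN x).symm

end BoxSpline

/-- For the box splines with all scales equal to `σ √(24 / N)`: the pointwise defined function
`boxSpline` is the density of the `N`-fold convolution for every order `N ≥ 2`, it is the continuous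
density for `N ≥ 3`, and as `N → ∞` it converges pointwise to the isotropic Gaussian. -/
theorem theorem1 (σ : ℝ) (hσ : 0 < σ) :
    (∀ N : ℕ, 2 ≤ N →
      (∀ᵐ x, 0 ≤ BoxSpline.boxSpline N (BoxSpline.scaleVector σ N) x) ∧
      BoxSpline.boxSplineMeasure N (BoxSpline.scaleVector σ N) =
        (volume : Measure BoxSpline.Plane).withDensity
          (fun x => ENNReal.ofReal (BoxSpline.boxSpline N (BoxSpline.scaleVector σ N) x))) ∧
    (∀ N : ℕ, 3 ≤ N → Continuous (BoxSpline.boxSpline N (BoxSpline.scaleVector σ N))) ∧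
    ∀ x : BoxSpline.Plane,
      Tendsto (fun N : ℕ => BoxSpline.boxSpline N (BoxSpline.scaleVector σ N) x) atTop
        (𝓝 (1 / (2 * Real.pi * σ ^ 2) * Real.exp (-‖x‖ ^ 2 / (2 * σ ^ 2)))) :=
  ⟨fun _ hN => ⟨BoxSpline.boxSpline_ae_nonneg (BoxSpline.scaleVector_pos hσ),
      BoxSpline.boxSplineMeasure_eq_withDensity hN (BoxSpline.scaleVector_pos hσ)⟩,
    fun _ hN => BoxSpline.continuous_boxSpline hσ hN, BoxSpline.tendsto_boxSpline hσ⟩
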